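/- Let $c\in\mathbb R^{n_x}$, $A\in\mathbb R^{p\times n_x}$, $b\in\mathbb R^p$, $D\in\mathbb R^{K\times n_x}$, $E\in\mathbb R^{K\times n_\omega}$, $f\in\mathbb R^K$ with $K\ge 1$; let $d_k^\top, e_k^\top$ be the $k$-th rows of $D$ and $E$, and let $Z(x,\omega):=\max_{1\le k\le K}\,(d_k^\top x+e_k^\top\omega-f_k)$. Let $\Omega:=\{\omega\in\mathbb R^{n_\omega}: G\omega\le h\}$ be a polyhedron, with $G\in\mathbb R^{m\times n_\omega}$ and $h\in\mathbb R^m$, let $\widehat\omega_1,\dots,\widehat\omega_N\in\Omega$ ($N\ge 1$), and let $\alpha\in(0,1)$ and $\theta\ge 0$. Let $\|\cdot\|$ be the Euclidean norm, let $\mathcal P_1(\Omega)$ be the set of probability distributions concentrated on $\Omega$ with finite first moment, and let $$\mathcal M_N^\theta:=\Big\{\mu\in\mathcal P_1(\Omega): W_1\Big(\mu,\ \tfrac1N\sum_{i=1}^N\delta_{\widehat\omega_i}\Big)\le\theta\Big\},$$ where $W_1$ is the 1-Wasserstein distance for the metric induced by $\|\cdot\|$. Then the distributionally robust CVaR-constrained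 program $$\min_{x\in\mathbb R^{n_x}} c^\top x\quad\text{s.t.}\quad Ax\le b,\qquad \sup_{\mathbb P\in\mathcal M_N^\theta}\ \inf_{t\in\mathbb R}\Big[\tfrac1\alpha\,\mathbb E_{\mathbb P}\big[(Z(x,\omega)+t)_+\big]-t\Big]\le 0 \tag{1}$$ is equivalent to the finite-dimensional convex program $$\begin{aligned}\min_{x,\lambda,t,s,\eta}\quad & c^\top x\\ \text{s.t.}\quad & Ax\le b,\qquad \lambda\theta+\tfrac1N\sum_{i=1}^N s_i\le t\alpha,\\ & d_k^\top x-f_k+t+(e_k-G^\top\eta_{ik})^\top\widehat\omega_i+\eta_{ik}^\top h\le s_i,\\ & \|e_k-G^\top\eta_{ik}\|\le\lambda,\qquad \eta_{ik}\ge 0,\\ & t\in\mathbb R,\qquad \lambda\ge 0,\qquad s_i\ge 0,\end{aligned}\tag{2}$$ where $s\in\mathbb R^N$, $\eta_{ik}\in\mathbb R^m$, and the constraints involving $s_i$ and $\eta_{ik}$ hold for all $1\le i\le N$ and $1\le k\le K$. That is: a point $x$ is feasible for (1) if and only if there are $\lambda,t,s,\eta$ such that $(x,\lambda,t,s,\eta)$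 is feasible for (2); the two programs have the same optimal value in $[-\infty,\infty]$; a point $x$ is an optimal solution of (1) if and only if it is the $x$-component of an optimal solution of (2); and the feasible set of (2) is convex, as is its objective on that set. -/

import Mathlib

open MeasureTheory
open scoped Matrix ENNReal

noncomputable section

namespace DRCVP

/-- The uncertainty space `ℝ^n` with its Euclidean norm and Borel σ-algebra. -/
abbrev Unc (n : ℕ) : Type := EuclideanSpace ℝ (Fin n)

/-- The polyhedron `{ω | G ω ≤ h}`. -/
def polyhedron {n m : ℕ} (G : Matrix (Fin m) (Fin n) ℝ) (h : Fin m → ℝ) : Set (Unc n) :=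
  {ω | G *ᵥ ω.ofLp ≤ h}

/-- The constraint function `Z(x, ω) = max_k (d_kᵀ x + e_kᵀ ω - f_k)`, where `d_k` and `e_k` are
the rows of `D` and `E`. (For `0 < K` the supremum is a maximum over a finite nonempty set.) -/
def constraintFn {nx n K : ℕ} (D : Matrix (Fin K) (Fin nx) ℝ) (E : Matrix (Fin K) (Fin n) ℝ)
    (f : Fin K → ℝ) (x : Fin nx → ℝ) (ω : Unc n) : ℝ :=
  ⨆ k : Fin K, (D k ⬝ᵥ x + E k ⬝ᵥ ω.ofLp - f k)

/-- Couplings of `μ` and `ν`: measures on the product with marginals `μ` and `ν`. -/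
def couplings {n : ℕ} (μ ν : Measure (Unc n)) : Set (Measure (Unc n × Unc n)) :=
  {π | π.map Prod.fst = μ ∧ π.map Prod.snd = ν}

/-- The 1-Wasserstein distance for the Euclidean ground metric, with values in `[0, ∞]`. -/
def wasserstein {n : ℕ} (μ ν : Measure (Unc n)) : ℝ≥0∞ :=
  ⨅ π ∈ couplings μ ν, ∫⁻ z, edist z.1 z.2 ∂π

/-- The empirical distribution `(1/N) ∑ δ_{ω̂_i}`. -/
def empirical {n N : ℕ} (samples : Fin N → Unc n) : Measure (Unc n) :=
  (N : ℝ≥0∞)⁻¹ • ∑ i, Measure.dirac (samples i)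

/-- Probability distributions supported on `Ω` with finite first moment. -/
def finiteFirstMoment {n : ℕ} (Ω : Set (Unc n)) : Set (Measure (Unc n)) :=
  {P | IsProbabilityMeasure P ∧ P Ωᶜ = 0 ∧ Integrable (fun ω => ‖ω‖) P}

/-- The 1-Wasserstein ball of radius `θ` about the empirical distribution, inside the
distributions on `Ω` with finite first moment. -/
def ambiguitySet {n N : ℕ} (Ω : Set (Unc n)) (samples : Fin N → Unc n) (θ : ℝ) :
    Set (Measure (Unc n)) :=
  {P ∈ finiteFirstMoment Ω | wasserstein P (empirical samples) ≤ ENNReal.ofReal θ}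

/-- Conditional value-at-risk at level `α` of a loss `Z` under `P`, in the parametrization
`inf_t [(1/α) E_P (Z + t)_+ - t]` (the usual one with `t` replaced by `-t`). -/
def cvar {n : ℕ} (α : ℝ) (P : Measure (Unc n)) (Z : Unc n → ℝ) : EReal :=
  ⨅ t : ℝ, (((1 / α) * ∫ ω, max (Z ω + t) 0 ∂P - t : ℝ) : EReal)

/-- Data of a distributionally robust CVaR-constrained linear program: `nx` decision variables,
`n` uncertain parameters, `p` deterministic constraints, `K` uncertain constraints, a support
polyhedron with `m` inequalities, `N` samples, CVaR level `α` and Wasserstein radius `θ`. -/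
structure Data (nx n p K m N : ℕ) where
  c : Fin nx → ℝ
  A : Matrix (Fin p) (Fin nx) ℝ
  b : Fin p → ℝ
  D : Matrix (Fin K) (Fin nx) ℝ
  E : Matrix (Fin K) (Fin n) ℝ
  f : Fin K → ℝ
  G : Matrix (Fin m) (Fin n) ℝ
  h : Fin m → ℝ
  samples : Fin N → Unc n
  α : ℝ
  θ : ℝ

variable {nx n p K m N : ℕ}

/-- Feasible set of the distributionally robust program:
`A x ≤ b` and `sup_{P ∈ M} CVaR_α^P (Z(x, ·)) ≤ 0`. -/
def Data.robustFeasible (d : Data nx n p K m N) : Set (Fin nx → ℝ) :=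
  {x | d.A *ᵥ x ≤ d.b ∧
    (⨆ P ∈ ambiguitySet (polyhedron d.G d.h) d.samples d.θ,
      cvar d.α P (constraintFn d.D d.E d.f x)) ≤ 0}

/-- Decision variables `(x, lam, t, s, η)` of the reformulation. -/
abbrev Vars (nx K m N : ℕ) : Type :=
  (Fin nx → ℝ) × ℝ × ℝ × (Fin N → ℝ) × (Fin N → Fin K → Fin m → ℝ)

/-- The constraints of the finite-dimensional reformulation. -/
structure Data.Tractable (d : Data nx n p K m N) (x : Fin nx → ℝ) (lam t : ℝ)
    (s : Fin N → ℝ) (η : Fin N → Fin K → Fin m → ℝ) : Prop where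
  det : d.A *ᵥ x ≤ d.b
  budget : lam * d.θ + (1 / (N : ℝ)) * ∑ i, s i ≤ t * d.α
  epigraph : ∀ i k, d.D k ⬝ᵥ x - d.f k + t
      + (d.E k - d.Gᵀ *ᵥ η i k) ⬝ᵥ (d.samples i).ofLp + η i k ⬝ᵥ d.h ≤ s i
  dual_norm : ∀ i k, ‖WithLp.toLp 2 (d.E k - d.Gᵀ *ᵥ η i k)‖ ≤ lam
  eta_nonneg : ∀ i k, 0 ≤ η i k
  lam_nonneg : 0 ≤ lam
  s_nonneg : ∀ i, 0 ≤ s i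

/-- Feasible set of the reformulation. -/
def Data.tractableFeasible (d : Data nx n p K m N) : Set (Vars nx K m N) :=
  {v | d.Tractable v.1 v.2.1 v.2.2.1 v.2.2.2.1 v.2.2.2.2}

/-- Objective `cᵀ x` of the distributionally robust program. -/
def Data.robustCost (d : Data nx n p K m N) (x : Fin nx → ℝ) : ℝ := d.c ⬝ᵥ x

/-- Objective `cᵀ x` of the reformulation. -/
def Data.tractableCost (d : Data nx n p K m N) (v : Vars nx K m N) : ℝ := d.c ⬝ᵥ v.1

/-- Optimal value of `min cost` over `S`, in `[-∞, ∞]` (`∞` if `S` is empty). -/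
def optValue {V : Type} (S : Set V) (cost : V → ℝ) : EReal := ⨅ v ∈ S, (cost v : EReal)

/-- `v` is an optimal solution of `min cost` over `S`. -/
def IsOptimal {V : Type} (S : Set V) (cost : V → ℝ) (v : V) : Prop := v ∈ S ∧ IsMinOn cost S v

end DRCVP

end

/-! Both inclusions are Lagrangian duality for the transport budget. From (2) to (1), the
constraints on `s`, `lam` and `η` give `max (Z + t) 0 ≤ s i + lam * ‖a - ω i‖` on the support, and
integrating this against couplings bounds every expectation over the Wasserstein ball
(`integral_le_of_mem_ambiguitySet`).

The converse needs one level `t` and one multiplier `lam` that serve all distributions at once.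
`exists_level_multiplier` finds them by a minimax argument. Only finite mixtures of perturbed
empirical measures have to be tested, and the pair can be confined to a compact box because the loss
is Lipschitz and `α < 1`. The resulting bound is separable over the samples, so
`exists_bounds_sum_le` splits it into the `s i`. For each sample and each affine piece, a second
minimax argument replaces the distance by a linear functional of norm at most `lam`
(`exists_norm_le_forall_sub_inner_le`). What remains is an affine inequality on the polyhedron,
whose Farkas multiplier is `η i k`.

The statements on values and minimizers follow because the cost depends only on `x`. -/

namespace DRCVP

/-! ### Farkas lemmas -/

/-- Homogeneous Farkas lemma for finitely many linear functionals. -/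
theorem exists_nonneg_combination_of_forall_nonpos {V : Type*} [AddCommGroup V] [Module ℝ V]
    (m : ℕ) (a : Fin m → V →ₗ[ℝ] ℝ) (v : V →ₗ[ℝ] ℝ)
    (hv : ∀ x, (∀ j, a j x ≤ 0) → v x ≤ 0) :
    ∃ η : Fin m → ℝ, (∀ j, 0 ≤ η j) ∧ v = ∑ j, η j • a j := by
  induction m generalizing v with
  | zero =>
    refine ⟨0, fun j => j.elim0, ?_⟩
    ext x
    have h1 := hv x (fun j => j.elim0)
    have h2 := hv (-x) (fun j => j.elim0)
    rw [map_neg] at h2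
    simp only [Finset.univ_eq_empty, Finset.sum_empty, LinearMap.zero_apply]
    linarith
  | succ m ih =>
    -- Either the last functional is superfluous and gets multiplier `0`, or a witness against this
    -- forces it to be positive there; rescaling makes it `1` at `x₀`.
    by_cases hfirst : ∀ x, (∀ j : Fin m, a j.castSucc x ≤ 0) → v x ≤ 0
    · obtain ⟨η, hη, hsum⟩ := ih (fun j => a j.castSucc) v hfirst
      refine ⟨Fin.snoc η 0, fun j => ?_, ?_⟩
      · refine Fin.lastCases ?_ (fun i => ?_) j
        · simp
        · simpa using hη i
      · rw [Fin.sum_univ_castSucc]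
        simpa using hsum
    · push Not at hfirst
      obtain ⟨x₁, hx₁, hvx₁⟩ := hfirst
      have hlast : 0 < a (Fin.last m) x₁ := by
        by_contra! hle
        refine hvx₁.not_ge (hv x₁ fun j => ?_)
        exact Fin.lastCases hle hx₁ j
      obtain ⟨x₀, hx₀, hvx₀, hone⟩ : ∃ x₀, (∀ j : Fin m, a j.castSucc x₀ ≤ 0) ∧ 0 < v x₀ ∧
          a (Fin.last m) x₀ = 1 := by
        refine ⟨(a (Fin.last m) x₁)⁻¹ • x₁, fun j => ?_, ?_, ?_⟩
        · rw [map_smul, smul_eq_mul]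
          exact mul_nonpos_of_nonneg_of_nonpos (inv_nonneg.2 hlast.le) (hx₁ j)
        · rw [map_smul, smul_eq_mul]
          positivity
        · rw [map_smul, smul_eq_mul, inv_mul_cancel₀ hlast.ne']
      -- Compose all functionals with the projection along `x₀` onto the kernel of the last one. The
      -- last constraint then holds with equality and drops out.
      obtain ⟨η, hη, hsum⟩ := ih (fun j => a j.castSucc - a j.castSucc x₀ • a (Fin.last m))
        (v - v x₀ • a (Fin.last m)) (fun x hx => by
          have := hv (x - a (Fin.last m) x • x₀) (fun j => by
            refine Fin.lastCases ?_ (fun i => ?_) j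
            · simp [hone]
            · have := hx i
              simp only [LinearMap.sub_apply, LinearMap.smul_apply, smul_eq_mul] at this
              simp only [map_sub, map_smul, smul_eq_mul]
              linarith)
          simp only [map_sub, map_smul, smul_eq_mul] at this
          simp only [LinearMap.sub_apply, LinearMap.smul_apply, smul_eq_mul]
          linarith)
      refine ⟨Fin.snoc η (v x₀ - ∑ j, η j * a j.castSucc x₀), fun j => ?_, ?_⟩
      · refine Fin.lastCases ?_ (fun i => ?_) j
        · rw [Fin.snoc_last]
          have : ∑ j, η j * a j.castSucc x₀ ≤ 0 :=
            Finset.sum_nonpos fun j _ => mul_nonpos_of_nonneg_of_nonpos (hη j) (hx₀ j)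
          linarith
        · simpa using hη i
      · ext x
        have hx := congrArg (fun g : V →ₗ[ℝ] ℝ => g x) hsum
        simp only [LinearMap.sub_apply, LinearMap.smul_apply, smul_eq_mul, LinearMap.sum_apply,
          mul_sub, Finset.sum_sub_distrib] at hx
        rw [Fin.sum_univ_castSucc]
        simp only [Fin.snoc_castSucc, Fin.snoc_last, LinearMap.add_apply, LinearMap.sum_apply,
          LinearMap.smul_apply, smul_eq_mul, sub_mul, Finset.sum_mul]
        have e : ∑ j, η j * (a j.castSucc x₀ * a (Fin.last m) x)
            = ∑ j, η j * a j.castSucc x₀ * a (Fin.last m) x :=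
          Finset.sum_congr rfl fun j _ => by ring
        linarith

/-- Affine Farkas lemma: a linear inequality valid on a nonempty polyhedron is dominated by a
nonnegative combination of the defining inequalities. -/
theorem exists_nonneg_multiplier_of_forall_polyhedron {n m : ℕ} (G : Matrix (Fin m) (Fin n) ℝ)
    (h : Fin m → ℝ) (v : Fin n → ℝ) (β : ℝ) (hne : ∃ x, G *ᵥ x ≤ h)
    (hv : ∀ x, G *ᵥ x ≤ h → v ⬝ᵥ x ≤ β) :
    ∃ η : Fin m → ℝ, 0 ≤ η ∧ Gᵀ *ᵥ η = v ∧ η ⬝ᵥ h ≤ β := by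
  obtain ⟨x₀, hx₀⟩ := hne
  let fst := LinearMap.fst ℝ (Fin n → ℝ) ℝ
  let snd := LinearMap.snd ℝ (Fin n → ℝ) ℝ
  let row (u : Fin n → ℝ) : (Fin n → ℝ) →ₗ[ℝ] ℝ := dotProductBilin ℝ ℝ u
  have hrow (u x : Fin n → ℝ) : row u x = u ⬝ᵥ x := rfl
  -- Homogenize with a variable `τ ≥ 0`. For `τ > 0` rescale to the polyhedron; for `τ = 0` the
  -- vector is a recession direction, along which `v` cannot increase.
  obtain ⟨η, hη, hsum⟩ := exists_nonneg_combination_of_forall_nonpos (m + 1)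
    (Fin.snoc (α := fun _ => ((Fin n → ℝ) × ℝ) →ₗ[ℝ] ℝ)
      (fun j => (row (G j)).comp fst - h j • snd) (-snd))
    ((row v).comp fst - β • snd) (by
      rintro ⟨x, τ⟩ hx
      have hτ : 0 ≤ τ := by simpa [snd] using hx (Fin.last m)
      have hG : ∀ j, G j ⬝ᵥ x ≤ h j * τ := fun j => by
        simpa [fst, snd, hrow] using hx j.castSucc
      simp only [LinearMap.sub_apply, LinearMap.comp_apply, LinearMap.smul_apply, smul_eq_mul, fst,
        snd, LinearMap.fst_apply, LinearMap.snd_apply, hrow]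
      rcases hτ.eq_or_lt with rfl | hpos
      · by_contra! hlt
        simp only [mul_zero, sub_zero] at hlt hG
        have key : ∀ r : ℝ, 0 ≤ r → v ⬝ᵥ x₀ + r * (v ⬝ᵥ x) ≤ β := fun r hr => by
          have := hv (x₀ + r • x) (fun j => by
            have h1 : G j ⬝ᵥ x₀ ≤ h j := hx₀ j
            have h2 := mul_nonpos_of_nonneg_of_nonpos hr (hG j)
            change G j ⬝ᵥ (x₀ + r • x) ≤ h j
            rw [dotProduct_add, dotProduct_smul, smul_eq_mul]
            linarith)
          rwa [dotProduct_add, dotProduct_smul, smul_eq_mul] at this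
        have h0 := key 0 le_rfl
        have h1 := key ((β - v ⬝ᵥ x₀ + 1) / (v ⬝ᵥ x)) (by
          apply div_nonneg _ hlt.le
          linarith)
        rw [div_mul_cancel₀ _ hlt.ne'] at h1
        linarith
      · have := hv (τ⁻¹ • x) (fun j => by
          change G j ⬝ᵥ (τ⁻¹ • x) ≤ h j
          rw [dotProduct_smul, smul_eq_mul, inv_mul_le_iff₀ hpos, mul_comm]
          exact hG j)
        rw [dotProduct_smul, smul_eq_mul, inv_mul_le_iff₀ hpos] at this
        linarith)
  rw [Fin.sum_univ_castSucc] at hsum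
  simp only [Fin.snoc_castSucc, Fin.snoc_last] at hsum
  refine ⟨fun j => η j.castSucc, fun j => hη _, ?_, ?_⟩
  · refine dotProduct_eq _ _ fun x => ?_
    have hx := congrArg (fun g : ((Fin n → ℝ) × ℝ) →ₗ[ℝ] ℝ => g (x, 0)) hsum
    simp only [fst, snd, LinearMap.sub_apply, LinearMap.comp_apply, LinearMap.smul_apply,
      LinearMap.add_apply, LinearMap.sum_apply, LinearMap.neg_apply, smul_eq_mul,
      LinearMap.fst_apply, LinearMap.snd_apply, hrow, mul_zero, sub_zero, neg_zero,
      add_zero] at hx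
    rw [hx, Matrix.mulVec_transpose, ← Matrix.dotProduct_mulVec]
    rfl
  · have hx := congrArg (fun g : ((Fin n → ℝ) × ℝ) →ₗ[ℝ] ℝ => g (0, 1)) hsum
    simp only [fst, snd, LinearMap.sub_apply, LinearMap.comp_apply, LinearMap.smul_apply,
      LinearMap.add_apply, LinearMap.sum_apply, LinearMap.neg_apply, smul_eq_mul,
      LinearMap.fst_apply, LinearMap.snd_apply, map_zero, mul_one, zero_sub, mul_neg,
      Finset.sum_neg_distrib] at hx
    have := hη (Fin.last m)
    simp only [dotProduct]
    linarith

/-! ### Minimax and separable bounds -/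

/-- A minimax principle: if every finite convex combination of a family of continuous convex
functions on a compact convex set has nonpositive infimum, then some point makes all members of
the family nonpositive. -/
theorem exists_forall_nonpos_of_weighted {E : Type*} [AddCommGroup E] [Module ℝ E]
    [TopologicalSpace E] {X : Set E} (hX : IsCompact X) {Y : Type} [Nonempty Y] (F : E → Y → ℝ)
    (hconv : ∀ y, ConvexOn ℝ X fun x => F x y) (hcont : ∀ y, Continuous fun x => F x y)
    (hF : ∀ (ι : Type) [Fintype ι] (w : ι → ℝ) (y : ι → Y), (∀ j, 0 ≤ w j) → ∑ j, w j = 1 →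
      ∀ ε > 0, ∃ x ∈ X, ∑ j, w j * F x (y j) ≤ ε) :
    ∃ x ∈ X, ∀ y, F x y ≤ 0 := by
  by_contra! hcon
  -- A trivial combination serves only to show that `X` is nonempty.
  obtain ⟨x₀, hx₀, -⟩ := hF Unit (fun _ => 1) (fun _ => Classical.arbitrary Y)
    (fun _ => zero_le_one) (by simp) 1 one_pos
  obtain ⟨T, hT⟩ := hX.elim_finite_subcover
    (fun i : Y × Set.Ioi (0 : ℝ) => {x | (i.2 : ℝ) < F x i.1})
    (fun i => isOpen_lt continuous_const (hcont i.1))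
    (fun x hx => by
      obtain ⟨y, hy⟩ := hcon x hx
      exact Set.mem_iUnion.2 ⟨(y, ⟨F x y / 2, half_pos hy⟩), half_lt_self hy⟩)
  -- Separate the open negative orthant from the upward closure of the values over `X`, lowered by
  -- the thresholds of the finite cover. Upward closedness makes the separating weights nonnegative,
  -- and the positive thresholds leave a uniform gap that contradicts `hF`.
  let O : Set (T → ℝ) := Set.univ.pi fun _ => Set.Iio 0
  let C : Set (T → ℝ) := {a | ∃ x ∈ X, ∀ j : T, F x j.1.1 - j.1.2 ≤ a j}
  have hO : Convex ℝ O := convex_pi fun _ _ => convex_Iio 0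
  have hOo : IsOpen O := isOpen_set_pi Set.finite_univ fun _ _ => isOpen_Iio
  have hC : Convex ℝ C := by
    rintro a ⟨x, hx, hxa⟩ b ⟨y, hy, hyb⟩ r s hr hs hrs
    refine ⟨r • x + s • y, (hconv (Classical.arbitrary Y)).1 hx hy hr hs hrs, fun j => ?_⟩
    have h1 := (hconv j.1.1).2 hx hy hr hs hrs
    have h2 := mul_le_mul_of_nonneg_left (hxa j) hr
    have h3 := mul_le_mul_of_nonneg_left (hyb j) hs
    have h4 : (j.1.2 : ℝ) = r * j.1.2 + s * j.1.2 := by rw [← add_mul, hrs, one_mul]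
    simp only [smul_eq_mul, Pi.add_apply, Pi.smul_apply] at h1 ⊢
    linarith
  have hdisj : Disjoint O C := by
    rw [Set.disjoint_left]
    rintro a ha ⟨x, hx, hxa⟩
    obtain ⟨i, hi, hlt⟩ := Set.mem_iUnion₂.1 (hT hx)
    have h1 := hxa ⟨i, hi⟩
    have h2 : a ⟨i, hi⟩ < 0 := ha ⟨i, hi⟩ trivial
    simp only [Set.mem_ofPred_eq] at hlt
    linarith
  obtain ⟨f, u, hfO, hfC⟩ := geometric_hahn_banach_open hO hOo hC hdisj
  classical
  let w : T → ℝ := fun j => f (Pi.single j 1)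
  have hf : ∀ a, f a = ∑ j, w j * a j := fun a => by
    conv_lhs => rw [pi_eq_sum_univ' a]
    rw [map_sum]
    exact Finset.sum_congr rfl fun j _ => by
      rw [map_smul, smul_eq_mul, mul_comm]
  have hw : ∀ j, 0 ≤ w j := fun j => by
    by_contra! hneg
    let a : T → ℝ := fun j => F x₀ j.1.1 - j.1.2
    have key : ∀ r : ℝ, 0 ≤ r → u ≤ f a + r * w j := fun r hr => by
      have := hfC (a + r • Pi.single j 1) ⟨x₀, hx₀, fun i => by
        have : (0 : ℝ) ≤ (Pi.single j 1 : T → ℝ) i := by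
          by_cases hij : i = j
          · subst hij; simp
          · simp [hij]
        have := mul_nonneg hr this
        simp only [Pi.add_apply, Pi.smul_apply, smul_eq_mul, a]
        linarith⟩
      rwa [map_add, map_smul, smul_eq_mul] at this
    have h0 := key 0 le_rfl
    have h1 := key ((u - f a - 1) / w j) (div_nonneg_of_nonpos (by linarith) hneg.le)
    rw [div_mul_cancel₀ _ hneg.ne] at h1
    linarith
  have hu : ∀ τ > 0, -τ * ∑ j, w j < u := fun τ hτ => by
    have := hfO (fun _ => -τ) (fun _ _ => by simpa using hτ)
    rwa [hf, ← Finset.sum_mul, mul_comm] at this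
  have hval : ∀ x ∈ X, u ≤ ∑ j, w j * (F x j.1.1 - j.1.2) := fun x hx => by
    rw [← hf]
    exact hfC _ ⟨x, hx, fun j => le_rfl⟩
  have hW : 0 < ∑ j, w j := by
    refine (Finset.sum_nonneg fun j _ => hw j).lt_of_ne' fun h0 => ?_
    have hz := (Finset.sum_eq_zero_iff_of_nonneg fun j _ => hw j).1 h0
    have h1 := hu 1 one_pos
    have h2 := hval x₀ hx₀
    rw [Finset.sum_eq_zero fun j hj => by rw [hz j hj, zero_mul]] at h2
    rw [h0] at h1
    linarith
  have hu0 : 0 ≤ u := by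
    by_contra! hneg
    have := hu (-u / ∑ j, w j) (div_pos (by linarith) hW)
    rw [neg_mul, div_mul_cancel₀ _ hW.ne'] at this
    linarith
  set W := ∑ j, w j with hWdef
  have hc : 0 < ∑ j : T, w j * (j.1.2 : ℝ) := by
    obtain ⟨j, hj⟩ : ∃ j, 0 < w j := by
      by_contra! hle
      exact hW.not_ge (Finset.sum_nonpos fun j _ => hle j)
    exact Finset.sum_pos' (fun j _ => mul_nonneg (hw j) (le_of_lt j.1.2.2))
      ⟨j, Finset.mem_univ _, mul_pos hj j.1.2.2⟩
  obtain ⟨x, hx, hle⟩ := hF T (fun j => w j / W) (fun j => j.1.1)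
    (fun j => div_nonneg (hw j) hW.le) (by rw [← Finset.sum_div, div_self hW.ne'])
    ((∑ j : T, w j * (j.1.2 : ℝ)) / W / 2) (half_pos (div_pos hc hW))
  have h1 := hval x hx
  simp only [mul_sub, Finset.sum_sub_distrib] at h1
  have h2 : ∑ j : T, w j / W * F x j.1.1 = (∑ j : T, w j * F x j.1.1) / W := by
    rw [Finset.sum_div]
    exact Finset.sum_congr rfl fun j _ => by ring
  rw [h2] at hle
  have h3 : (∑ j : T, w j * (j.1.2 : ℝ)) / W ≤ (∑ j : T, w j * F x j.1.1) / W :=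
    div_le_div_of_nonneg_right (by linarith) hW.le
  have h4 := div_pos hc hW
  linarith

/-- If a separable sum is bounded over a nonempty product set, its terms admit individual upper
bounds with the same total. -/
theorem exists_bounds_sum_le {α : Type*} {N : ℕ} {S : Set α} (hS : S.Nonempty)
    (g : Fin N → α → ℝ) (C : ℝ) (hg : ∀ y : Fin N → α, (∀ i, y i ∈ S) → ∑ i, g i (y i) ≤ C) :
    ∃ s : Fin N → ℝ, (∀ i, ∀ a ∈ S, g i a ≤ s i) ∧ ∑ i, s i ≤ C := by
  obtain ⟨a₀, ha₀⟩ := hS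
  have hbdd : ∀ i, BddAbove (g i '' S) := fun i => by
    refine ⟨C - ∑ j ∈ Finset.univ.erase i, g j a₀, ?_⟩
    rintro _ ⟨a, ha, rfl⟩
    have := hg (Function.update (fun _ => a₀) i a) (fun j => by
      by_cases hj : j = i
      · subst hj; simpa
      · simpa [hj])
    rw [← Finset.add_sum_erase _ _ (Finset.mem_univ i)] at this
    rw [Finset.sum_congr rfl (g := fun j => g j a₀) fun j hj => by
      rw [Function.update_of_ne (Finset.ne_of_mem_erase hj)]] at this
    rw [Function.update_self] at this
    linarith
  refine ⟨fun i => sSup (g i '' S), fun i a ha => le_csSup (hbdd i) ⟨a, ha, rfl⟩, ?_⟩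
  refine le_of_forall_pos_le_add fun ε hε => ?_
  -- The denominator `N + 1` also covers `N = 0`.
  have hδ : 0 < ε / (N + 1) := by positivity
  have hex : ∀ i, ∃ a ∈ S, sSup (g i '' S) - ε / (N + 1) < g i a := fun i => by
    obtain ⟨_, ⟨a, ha, rfl⟩, hlt⟩ :=
      exists_lt_of_lt_csSup (Set.Nonempty.image (g i) ⟨a₀, ha₀⟩) (sub_lt_self _ hδ)
    exact ⟨a, ha, hlt⟩
  choose y hyS hy using hex
  have h1 := hg y hyS
  have h2 : ∑ i, (sSup (g i '' S) - ε / (N + 1)) ≤ ∑ i, g i (y i) :=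
    Finset.sum_le_sum fun i _ => (hy i).le
  rw [Finset.sum_sub_distrib, Finset.sum_const, Finset.card_univ, Fintype.card_fin,
    nsmul_eq_mul] at h2
  have h3 : (N : ℝ) * (ε / (N + 1)) ≤ ε := by
    rw [mul_div_assoc', div_le_iff₀ (by positivity)]
    nlinarith
  linarith

theorem dotProduct_ofLp_le {n : ℕ} (v : Fin n → ℝ) (z : Unc n) :
    v ⬝ᵥ z.ofLp ≤ ‖WithLp.toLp 2 v‖ * ‖z‖ := by
  have := real_inner_le_norm (WithLp.toLp 2 v : Unc n) z
  rwa [EuclideanSpace.inner_eq_star_dotProduct, star_trivial, dotProduct_comm] at this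

/-! ### Lipschitz estimate for the constraint function -/

section constraintFn

variable {nx n K : ℕ} (D : Matrix (Fin K) (Fin nx) ℝ) (E : Matrix (Fin K) (Fin n) ℝ)
  (f : Fin K → ℝ) (x : Fin nx → ℝ)

theorem le_constraintFn (ω : Unc n) (k : Fin K) :
    D k ⬝ᵥ x + E k ⬝ᵥ ω.ofLp - f k ≤ constraintFn D E f x ω :=
  le_ciSup (f := fun k => D k ⬝ᵥ x + E k ⬝ᵥ ω.ofLp - f k) (Set.finite_range _).bddAbove k

theorem constraintFn_le (hK : 0 < K) {ω : Unc n} {r : ℝ}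
    (h : ∀ k, D k ⬝ᵥ x + E k ⬝ᵥ ω.ofLp - f k ≤ r) : constraintFn D E f x ω ≤ r :=
  have : Nonempty (Fin K) := ⟨⟨0, hK⟩⟩
  ciSup_le h

/-- A Lipschitz constant of the constraint function in the uncertain parameters. -/
noncomputable def slope {n K : ℕ} (E : Matrix (Fin K) (Fin n) ℝ) : ℝ := ∑ k, ‖(WithLp.toLp 2 (E k) : Unc n)‖

theorem slope_nonneg : 0 ≤ slope E := Finset.sum_nonneg fun _ _ => norm_nonneg _

theorem constraintFn_le_add (hK : 0 < K) (ω ω' : Unc n) :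
    constraintFn D E f x ω ≤ constraintFn D E f x ω' + slope E * ‖ω - ω'‖ := by
  refine constraintFn_le D E f x hK fun k => ?_
  have h1 := le_constraintFn D E f x ω' k
  have h2 := dotProduct_ofLp_le (E k) (ω - ω')
  have h3 : ‖(WithLp.toLp 2 (E k) : Unc n)‖ ≤ slope E :=
    Finset.single_le_sum (f := fun k => ‖(WithLp.toLp 2 (E k) : Unc n)‖)
      (fun _ _ => norm_nonneg _) (Finset.mem_univ k)
  have h4 := mul_le_mul_of_nonneg_right h3 (norm_nonneg (ω - ω'))
  rw [WithLp.ofLp_sub, dotProduct_sub] at h2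
  linarith

theorem continuous_constraintFn (hK : 0 < K) : Continuous (constraintFn D E f x) := by
  refine (LipschitzWith.of_le_add_mul (slope E).toNNReal fun ω ω' => ?_).continuous
  rw [Real.coe_toNNReal _ (slope_nonneg E), dist_eq_norm]
  exact constraintFn_le_add D E f x hK ω ω'

end constraintFn

/-! ### Discrete measures in the ambiguity set -/

section weightedDiracs

variable {ι α β : Type*} [Fintype ι] [MeasurableSpace α] [MeasurableSpace β]

/-- The discrete measure with weights `w` (negative ones count as zero) at the points `y`. -/
noncomputable def weightedDiracs (w : ι → ℝ) (y : ι → α) : Measure α :=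
  ∑ j, ENNReal.ofReal (w j) • Measure.dirac (y j)

theorem lintegral_weightedDiracs (w : ι → ℝ) (y : ι → α) {g : α → ℝ≥0∞} (hg : Measurable g) :
    ∫⁻ a, g a ∂weightedDiracs w y = ∑ j, ENNReal.ofReal (w j) * g (y j) := by
  simp only [weightedDiracs, lintegral_finsetSum_measure, lintegral_smul_measure,
    lintegral_dirac' _ hg, smul_eq_mul]

theorem map_weightedDiracs (w : ι → ℝ) (y : ι → α) {g : α → β} (hg : Measurable g) :
    (weightedDiracs w y).map g = weightedDiracs w (g ∘ y) := by
  ext s hs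
  rw [Measure.map_apply hg hs]
  simp only [weightedDiracs, Measure.finsetSum_apply, Measure.smul_apply,
    Measure.dirac_apply' _ hs, Measure.dirac_apply' _ (hg hs)]
  rfl

variable [MeasurableSingletonClass α]

theorem integrable_weightedDiracs (w : ι → ℝ) (y : ι → α) (g : α → ℝ) :
    Integrable g (weightedDiracs w y) :=
  integrable_finsetSum_measure.2 fun _ _ =>
    (integrable_dirac (by simp)).smul_measure ENNReal.ofReal_ne_top

theorem integral_weightedDiracs {w : ι → ℝ} (hw : ∀ j, 0 ≤ w j) (y : ι → α) (g : α → ℝ) :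
    ∫ a, g a ∂weightedDiracs w y = ∑ j, w j * g (y j) := by
  rw [weightedDiracs, integral_finsetSum_measure fun _ _ =>
    (integrable_dirac (by simp)).smul_measure ENNReal.ofReal_ne_top]
  simp [integral_smul_measure, integral_dirac, ENNReal.toReal_ofReal (hw _)]

end weightedDiracs

/-- Splitting each atom according to `w` puts the empirical measure on the index set of a mixture,
so that matching equal indices yields a coupling. -/
theorem empirical_eq_weightedDiracs {n N : ℕ} (ω : Fin N → Unc n) (hN : 0 < N) {ι : Type}
    [Fintype ι] {w : ι → ℝ} (hw : ∀ j, 0 ≤ w j) (hsum : ∑ j, w j = 1) :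
    empirical ω = weightedDiracs (fun a : ι × Fin N => w a.1 * (1 / N)) (fun a => ω a.2) := by
  have hNr : (0 : ℝ) < N := Nat.cast_pos.2 hN
  rw [weightedDiracs, Fintype.sum_prod_type_right, empirical, Finset.smul_sum]
  refine Finset.sum_congr rfl fun i _ => ?_
  change _ = ∑ j, ENNReal.ofReal (w j * (1 / N)) • Measure.dirac (ω i)
  rw [← Finset.sum_smul, ← ENNReal.ofReal_sum_of_nonneg fun j _ => by
    have := hw j
    positivity, ← Finset.sum_mul, hsum, one_mul, one_div, ENNReal.ofReal_inv_of_pos hNr,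
    ENNReal.ofReal_natCast]

/-- Finite mixtures of empirical distributions with small average transport cost to the samples
belong to the ambiguity set. -/
theorem weightedDiracs_mem_ambiguitySet {n N : ℕ} {Ω : Set (Unc n)} (hΩ : MeasurableSet Ω)
    (ω : Fin N → Unc n) (hN : 0 < N) (θ : ℝ) {ι : Type} [Fintype ι] {w : ι → ℝ}
    (hw : ∀ j, 0 ≤ w j) (hsum : ∑ j, w j = 1) (y : ι → Fin N → Unc n) (hy : ∀ j i, y j i ∈ Ω)
    (hcost : ∑ j, w j * ((1 / N) * ∑ i, ‖y j i - ω i‖) ≤ θ) :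
    weightedDiracs (fun a : ι × Fin N => w a.1 * (1 / N)) (fun a => y a.1 a.2)
      ∈ ambiguitySet Ω ω θ := by
  have hNr : (0 : ℝ) < N := Nat.cast_pos.2 hN
  have hw' : ∀ a : ι × Fin N, 0 ≤ w a.1 * (1 / N) := fun a => by
    have := hw a.1
    positivity
  have htot : ∑ a : ι × Fin N, w a.1 * (1 / N : ℝ) = 1 := by
    rw [Fintype.sum_prod_type]
    simp only [Finset.sum_const, Finset.card_univ, Fintype.card_fin, nsmul_eq_mul]
    refine (Finset.sum_congr rfl fun j _ => ?_).trans hsum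
    field_simp
  refine ⟨⟨⟨?_⟩, ?_, integrable_weightedDiracs _ _ _⟩, ?_⟩
  · rw [← lintegral_one, lintegral_weightedDiracs _ _ measurable_const]
    simp only [mul_one]
    rw [← ENNReal.ofReal_sum_of_nonneg fun a _ => hw' a, htot, ENNReal.ofReal_one]
  · rw [← lintegral_indicator_one hΩ.compl, lintegral_weightedDiracs _ _
      (measurable_one.indicator hΩ.compl)]
    exact Finset.sum_eq_zero fun a _ => by simp [hy a.1 a.2]
  · have hcoupling : weightedDiracs (fun a : ι × Fin N => w a.1 * (1 / N))
        (fun a => (y a.1 a.2, ω a.2)) ∈ couplings (weightedDiracs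
          (fun a : ι × Fin N => w a.1 * (1 / N)) (fun a => y a.1 a.2)) (empirical ω) := by
      constructor
      · rw [map_weightedDiracs _ _ measurable_fst]
        rfl
      · rw [map_weightedDiracs _ _ measurable_snd, empirical_eq_weightedDiracs ω hN hw hsum]
        rfl
    refine (iInf₂_le _ hcoupling).trans ?_
    · rw [lintegral_weightedDiracs _ _ (measurable_fst.edist measurable_snd)]
      refine le_trans (le_of_eq ?_) (ENNReal.ofReal_le_ofReal hcost)
      simp only [edist_dist, dist_eq_norm]
      rw [Finset.sum_congr rfl fun a _ => (ENNReal.ofReal_mul (hw' a)).symm,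
        ← ENNReal.ofReal_sum_of_nonneg fun a _ => mul_nonneg (hw' a) (norm_nonneg _),
        Fintype.sum_prod_type]
      simp only [mul_assoc, Finset.mul_sum]

theorem measurableSet_polyhedron {n m : ℕ} (G : Matrix (Fin m) (Fin n) ℝ) (h : Fin m → ℝ) :
    MeasurableSet (polyhedron G h) := by
  refine (isClosed_le (f := fun ω : Unc n => G *ᵥ ω.ofLp) ?_ continuous_const).measurableSet
  exact Continuous.matrix_mulVec continuous_const (PiLp.continuous_ofLp 2 _)

/-! ### Weak duality -/

/-- Weak duality for the Wasserstein ball: a loss dominated by `s i + lam * dist · (ω i)` has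
worst-case expectation at most `lam * θ` plus the mean of `s`. -/
theorem integral_le_of_mem_ambiguitySet {n N : ℕ} {Ω : Set (Unc n)} {ω : Fin N → Unc n}
    (hN : 0 < N) {θ : ℝ} (hθ : 0 ≤ θ) {P : Measure (Unc n)} (hP : P ∈ ambiguitySet Ω ω θ)
    {g : Unc n → ℝ} (hg : Continuous g) (hg0 : ∀ a, 0 ≤ g a) {lam : ℝ} (hlam : 0 ≤ lam)
    {s : Fin N → ℝ} (hs : ∀ i, 0 ≤ s i)
    (hle : ∀ a ∈ Ω, ∀ i, g a ≤ s i + lam * ‖a - ω i‖) :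
    ∫ a, g a ∂P ≤ lam * θ + (1 / N) * ∑ i, s i := by
  have : Nonempty (Fin N) := ⟨⟨0, hN⟩⟩
  obtain ⟨⟨-, hsupp, -⟩, hW⟩ := hP
  -- Lower envelope of the cones at the samples. It extends the bound on `g` to every second
  -- coordinate `b`, so the second marginal can be integrated without identifying which sample `b`
  -- is.
  let S : Unc n → ℝ := fun b =>
    Finset.univ.inf' Finset.univ_nonempty fun i => s i + lam * ‖b - ω i‖
  have hScont : Continuous S := Continuous.finset_inf'_apply _ fun i _ => by fun_prop
  have hS0 : ∀ b, 0 ≤ S b := fun b => Finset.le_inf' _ _ fun i _ => by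
    have := hs i
    positivity
  have hSle : ∀ i, S (ω i) ≤ s i := fun i =>
    (Finset.inf'_le _ (Finset.mem_univ i)).trans (by simp)
  have hgS : ∀ a ∈ Ω, ∀ b, g a ≤ S b + lam * dist a b := fun a ha b => by
    rw [← sub_le_iff_le_add]
    refine Finset.le_inf' _ _ fun i _ => ?_
    have h1 := hle a ha i
    have h2 := mul_le_mul_of_nonneg_left (norm_sub_le_norm_sub_add_norm_sub a b (ω i)) hlam
    rw [dist_eq_norm]
    linarith
  have hmean : 0 ≤ (1 / N : ℝ) * ∑ i, s i :=
    mul_nonneg (by positivity) (Finset.sum_nonneg fun i _ => hs i)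
  have hSint : ∫⁻ b, ENNReal.ofReal (S b) ∂empirical ω
      ≤ ENNReal.ofReal ((1 / N : ℝ) * ∑ i, s i) := by
    rw [empirical_eq_weightedDiracs ω hN (ι := Unit) (w := fun _ => 1) (fun _ => zero_le_one)
      (by simp), lintegral_weightedDiracs _ _ (by fun_prop),
      Finset.sum_congr rfl fun a _ => (ENNReal.ofReal_mul (by positivity)).symm,
      ← ENNReal.ofReal_sum_of_nonneg fun a _ => mul_nonneg (by positivity) (hS0 _),
      Fintype.sum_prod_type]
    refine ENNReal.ofReal_le_ofReal ?_
    simp only [Finset.univ_unique, Finset.sum_singleton, one_mul, Finset.mul_sum]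
    exact Finset.sum_le_sum fun i _ => mul_le_mul_of_nonneg_left (hSle i) (by positivity)
  rw [integral_eq_lintegral_of_nonneg_ae (ae_of_all _ hg0) hg.aestronglyMeasurable]
  refine ENNReal.toReal_le_of_le_ofReal (by positivity) ?_
  have hπ : ∀ π ∈ couplings P (empirical ω), ∫⁻ a, ENNReal.ofReal (g a) ∂P
      ≤ ENNReal.ofReal ((1 / N : ℝ) * ∑ i, s i)
        + ENNReal.ofReal lam * ∫⁻ z, edist z.1 z.2 ∂π := by
    rintro π ⟨h1, h2⟩
    have hae : ∀ᵐ z ∂π, z.1 ∈ Ω := by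
      rw [← h1] at hsupp
      exact ae_of_ae_map measurable_fst.aemeasurable hsupp
    calc ∫⁻ a, ENNReal.ofReal (g a) ∂P = ∫⁻ z, ENNReal.ofReal (g z.1) ∂π := by
          rw [← h1, lintegral_map (by fun_prop) measurable_fst]
      _ ≤ ∫⁻ z, (ENNReal.ofReal (S z.2) + ENNReal.ofReal lam * edist z.1 z.2) ∂π := by
          refine lintegral_mono_ae (hae.mono fun z hz => ?_)
          rw [edist_dist, ← ENNReal.ofReal_mul hlam,
            ← ENNReal.ofReal_add (hS0 _) (mul_nonneg hlam dist_nonneg)]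
          exact ENNReal.ofReal_le_ofReal (hgS _ hz _)
      _ = ∫⁻ b, ENNReal.ofReal (S b) ∂empirical ω
            + ENNReal.ofReal lam * ∫⁻ z, edist z.1 z.2 ∂π := by
          rw [lintegral_add_left (by fun_prop), lintegral_const_mul _
            (measurable_fst.edist measurable_snd), ← h2, lintegral_map (by fun_prop)
            measurable_snd]
      _ ≤ _ := by gcongr
  -- No optimal coupling is assumed, so a nearly optimal one is used; dividing by `lam + 1` allows
  -- `lam = 0`.
  refine ENNReal.le_of_forall_pos_le_add fun ε hε _ => ?_
  have hδ : 0 < (ε : ℝ) / (lam + 1) := by positivity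
  have hlt : wasserstein P (empirical ω) < ENNReal.ofReal (θ + ε / (lam + 1)) :=
    hW.trans_lt ((ENNReal.ofReal_lt_ofReal_iff (by positivity)).2 (by linarith))
  simp only [wasserstein, iInf_lt_iff] at hlt
  obtain ⟨π, hmem, hcost⟩ := hlt
  refine (hπ π hmem).trans ((add_le_add_right (mul_le_mul_right hcost.le _) _).trans ?_)
  rw [← ENNReal.ofReal_mul hlam, ← ENNReal.ofReal_add hmean (by positivity),
    ← ENNReal.ofReal_coe_nnreal (p := ε), ← ENNReal.ofReal_add (by positivity) ε.coe_nonneg]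
  refine ENNReal.ofReal_le_ofReal ?_
  have : lam * ((ε : ℝ) / (lam + 1)) ≤ ε := by
    rw [mul_div_assoc', div_le_iff₀ (by positivity)]
    nlinarith [ε.2]
  linarith

/-! ### CVaR levels and strong duality -/

/-- A nonpositive conditional value-at-risk yields nearly optimal levels `t`. -/
theorem exists_lt_of_cvar_nonpos {n : ℕ} {α : ℝ} (hα : 0 < α) {P : Measure (Unc n)}
    {Z : Unc n → ℝ} (h : cvar α P Z ≤ 0) {ε : ℝ} (hε : 0 < ε) :
    ∃ t, ∫ ω, max (Z ω + t) 0 ∂P < t * α + ε * α := by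
  have hlt : cvar α P Z < (ε : EReal) := h.trans_lt (by exact_mod_cast hε)
  obtain ⟨t, ht⟩ := iInf_lt_iff.1 hlt
  refine ⟨t, ?_⟩
  rw [EReal.coe_lt_coe_iff, sub_lt_iff_lt_add, one_div, inv_mul_lt_iff₀ hα] at ht
  linarith

/-- A real inequality at one level `t` bounds the conditional value-at-risk. -/
theorem cvar_nonpos_of_le {n : ℕ} {α : ℝ} (hα : 0 < α) {P : Measure (Unc n)}
    {Z : Unc n → ℝ} {t : ℝ} (h : ∫ ω, max (Z ω + t) 0 ∂P ≤ t * α) : cvar α P Z ≤ 0 := by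
  refine (iInf_le _ t).trans ?_
  have : (1 / α) * ∫ ω, max (Z ω + t) 0 ∂P - t ≤ 0 := by
    rw [sub_nonpos, one_div, inv_mul_le_iff₀ hα]
    linarith
  exact_mod_cast this

/-- Duality for the worst-case conditional value-at-risk of a Lipschitz loss over a Wasserstein
ball: a common level `t` and a multiplier `lam` of the transport budget exist. -/
theorem exists_level_multiplier {n N : ℕ} {Ω : Set (Unc n)} (hΩ : MeasurableSet Ω)
    {ω : Fin N → Unc n} (hN : 0 < N) (hω : ∀ i, ω i ∈ Ω) {θ α : ℝ} (hθ : 0 ≤ θ) (hα : 0 < α)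
    (hα1 : α < 1) {Z : Unc n → ℝ} {L : ℝ} (hL : 0 ≤ L)
    (hZ : ∀ a b, Z a ≤ Z b + L * ‖a - b‖)
    (h : ∀ P ∈ ambiguitySet Ω ω θ, cvar α P Z ≤ 0) :
    ∃ t lam : ℝ, 0 ≤ lam ∧ ∀ y : Fin N → Unc n, (∀ i, y i ∈ Ω) →
      (1 / N) * ∑ i, (max (Z (y i) + t) 0 - lam * ‖y i - ω i‖) + lam * θ ≤ t * α := by
  have hNr : (0 : ℝ) < N := Nat.cast_pos.2 hN
  -- Upper bound for near-optimal levels: the expectation of `max (Z + t) 0` is at least the sample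
  -- mean of `Z` plus `t - L * θ`, which outgrows `t * α` since `α < 1`.
  let T : ℝ := (1 - ((1 / N) * ∑ i, Z (ω i) - L * θ)) / (1 - α)
  let Y : Type := {y : Fin N → Unc n // ∀ i, y i ∈ Ω}
  have : Nonempty Y := ⟨⟨ω, hω⟩⟩
  let F : ℝ × ℝ → Y → ℝ := fun x y =>
    (1 / N) * ∑ i, (max (Z (y.1 i) + x.1) 0 - x.2 * ‖y.1 i - ω i‖) + x.2 * θ - x.1 * α
  have hF : ∀ y, ConvexOn ℝ (Set.Icc (-1) T ×ˢ Set.Icc 0 L) fun x => F x y := fun y => by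
    refine ⟨(convex_Icc _ _).prod (convex_Icc _ _), fun x _ x' _ r s hr hs hrs => ?_⟩
    have key : ∀ i, max (Z (y.1 i) + (r * x.1 + s * x'.1)) 0
        - (r * x.2 + s * x'.2) * ‖y.1 i - ω i‖
        ≤ r * (max (Z (y.1 i) + x.1) 0 - x.2 * ‖y.1 i - ω i‖)
          + s * (max (Z (y.1 i) + x'.1) 0 - x'.2 * ‖y.1 i - ω i‖) := fun i => by
      have h1 : max (Z (y.1 i) + (r * x.1 + s * x'.1)) 0
          ≤ r * max (Z (y.1 i) + x.1) 0 + s * max (Z (y.1 i) + x'.1) 0 := by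
        refine max_le ?_ (by positivity)
        have h2 := mul_le_mul_of_nonneg_left (le_max_left (Z (y.1 i) + x.1) 0) hr
        have h3 := mul_le_mul_of_nonneg_left (le_max_left (Z (y.1 i) + x'.1) 0) hs
        have h4 : Z (y.1 i) = r * Z (y.1 i) + s * Z (y.1 i) := by rw [← add_mul, hrs, one_mul]
        linarith
      linarith
    have hsum := mul_le_mul_of_nonneg_left (Finset.sum_le_sum fun i (_ : i ∈ Finset.univ) => key i)
      (by positivity : (0 : ℝ) ≤ 1 / N)
    rw [Finset.sum_add_distrib, ← Finset.mul_sum, ← Finset.mul_sum] at hsum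
    simp only [F, Prod.fst_add, Prod.snd_add, Prod.smul_fst, Prod.smul_snd, smul_eq_mul]
    linarith
  obtain ⟨⟨t, lam⟩, ⟨-, hlam⟩, hall⟩ := exists_forall_nonpos_of_weighted
    (isCompact_Icc.prod isCompact_Icc) F hF (fun y => by fun_prop)
    (fun ι _ w y hw hsum ε hε => by
      let cost : ℝ := ∑ j, w j * ((1 / N) * ∑ i, ‖(y j).1 i - ω i‖)
      have hcost0 : 0 ≤ cost := Finset.sum_nonneg fun j _ => by
        have := hw j
        positivity
      -- A mixture within budget is used as it is, with `lam = 0`. Otherwise it is diluted with the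
      -- empirical measure until its cost is exactly `θ`; with `lam = L`, the penalty on the excess
      -- cost offsets the loss that dilution can hide.
      obtain ⟨β, lam, hβ0, hβ1, hβcost, hlam0, hlamL, hbal⟩ : ∃ β lam : ℝ, 0 ≤ β ∧ β ≤ 1 ∧
          β * cost ≤ θ ∧ 0 ≤ lam ∧ lam ≤ L ∧
          (1 - β) * (L * cost) + lam * (θ - cost) ≤ 0 := by
        rcases le_or_gt cost θ with hle | hgt
        · exact ⟨1, 0, by simp, le_rfl, by simpa using hle, le_rfl, hL, by simp⟩
        · have hpos : 0 < cost := hθ.trans_lt hgt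
          refine ⟨θ / cost, L, by positivity, (div_le_one hpos).2 hgt.le,
            (div_mul_cancel₀ _ hpos.ne').le, hL, le_rfl, le_of_eq ?_⟩
          field_simp
          ring
      let w' : Option ι → ℝ := fun j => j.elim (1 - β) fun j => β * w j
      let y' : Option ι → Fin N → Unc n := fun j => j.elim ω fun j => (y j).1
      have hw' : ∀ j, 0 ≤ w' j := by
        rintro (_ | j)
        · exact sub_nonneg.2 hβ1
        · exact mul_nonneg hβ0 (hw j)
      have hmix : ∀ g : (Fin N → Unc n) → ℝ,
          ∑ j, w' j * g (y' j) = (1 - β) * g ω + β * ∑ j, w j * g (y j).1 := fun g => by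
        rw [Fintype.sum_option, Finset.mul_sum]
        simp only [w', y', Option.elim, mul_assoc]
      have hsum' : ∑ j, w' j = 1 := by
        have := hmix fun _ => 1
        simp only [mul_one, hsum] at this
        linarith
      have hP := h _ (weightedDiracs_mem_ambiguitySet hΩ ω hN θ hw' hsum' y'
        (by rintro (_ | j); exacts [hω, (y j).2]) (by
          rw [hmix fun u => (1 / N) * ∑ i, ‖u i - ω i‖]
          simpa [cost] using hβcost))
      -- The cap `1` on the slack keeps `t` in the box: the expectation is nonnegative, so `t > -1`.
      obtain ⟨t, ht⟩ := exists_lt_of_cvar_nonpos hα hP (lt_min hε one_pos)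
      rw [integral_weightedDiracs (fun a => by have := hw' a.1; positivity),
        Fintype.sum_prod_type] at ht
      simp only [mul_assoc, ← Finset.mul_sum] at ht
      rw [hmix fun u => (1 / N) * ∑ i, max (Z (u i) + t) 0] at ht
      let base : ℝ := (1 / N) * ∑ i, max (Z (ω i) + t) 0
      let shifted : ℝ := ∑ j, w j * ((1 / N) * ∑ i, max (Z ((y j).1 i) + t) 0)
      have hbase : 0 ≤ base := by positivity
      have hshifted : 0 ≤ shifted := Finset.sum_nonneg fun j _ => by
        have := hw j
        positivity
      have hmean : ∀ r : ℝ, (1 / N : ℝ) * ∑ _i : Fin N, r = r := fun r => by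
        rw [Finset.sum_const, Finset.card_univ, Fintype.card_fin, nsmul_eq_mul]
        field_simp
      have hupper : shifted ≤ base + L * cost := by
        have hj : ∀ j, w j * ((1 / N) * ∑ i, max (Z ((y j).1 i) + t) 0)
            ≤ w j * base + L * (w j * ((1 / N) * ∑ i, ‖(y j).1 i - ω i‖)) := fun j => by
          have h1 : ∑ i, max (Z ((y j).1 i) + t) 0
              ≤ ∑ i, (max (Z (ω i) + t) 0 + L * ‖(y j).1 i - ω i‖) :=
            Finset.sum_le_sum fun i _ => by
              have h2 := hZ ((y j).1 i) (ω i)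
              have h3 := le_max_left (Z (ω i) + t) 0
              refine max_le (by linarith) (by positivity)
          rw [Finset.sum_add_distrib, ← Finset.mul_sum] at h1
          have h4 := mul_le_mul_of_nonneg_left
            (mul_le_mul_of_nonneg_left h1 (by positivity : (0 : ℝ) ≤ 1 / N)) (hw j)
          refine h4.trans (le_of_eq ?_)
          simp only [base]
          ring
        refine (Finset.sum_le_sum fun j _ => hj j).trans (le_of_eq ?_)
        rw [Finset.sum_add_distrib, ← Finset.sum_mul, hsum, one_mul, ← Finset.mul_sum]
      have hlower : (1 / N) * ∑ i, Z (ω i) + t - L * cost ≤ shifted := by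
        have hj : ∀ j, w j * ((1 / N) * ∑ i, Z (ω i) + t)
              - L * (w j * ((1 / N) * ∑ i, ‖(y j).1 i - ω i‖))
            ≤ w j * ((1 / N) * ∑ i, max (Z ((y j).1 i) + t) 0) := fun j => by
          have h1 : ∑ i, (Z (ω i) + t - L * ‖(y j).1 i - ω i‖)
              ≤ ∑ i, max (Z ((y j).1 i) + t) 0 :=
            Finset.sum_le_sum fun i _ => by
              have h2 := hZ (ω i) ((y j).1 i)
              rw [norm_sub_rev] at h2
              exact le_max_of_le_left (by linarith)
          rw [Finset.sum_sub_distrib, Finset.sum_add_distrib, ← Finset.mul_sum] at h1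
          have h4 := mul_le_mul_of_nonneg_left
            (mul_le_mul_of_nonneg_left h1 (by positivity : (0 : ℝ) ≤ 1 / N)) (hw j)
          refine le_trans (le_of_eq ?_) h4
          nth_rewrite 1 [← hmean t]
          ring
        refine le_trans (le_of_eq ?_) (Finset.sum_le_sum fun j _ => hj j)
        rw [Finset.sum_sub_distrib, ← Finset.sum_mul, hsum, one_mul, ← Finset.mul_sum]
      have hbase_lower : (1 / N) * ∑ i, Z (ω i) + t ≤ base := by
        have h1 : ∑ i, (Z (ω i) + t) ≤ ∑ i, max (Z (ω i) + t) 0 :=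
          Finset.sum_le_sum fun i _ => le_max_left _ _
        have h2 := mul_le_mul_of_nonneg_left h1 (by positivity : (0 : ℝ) ≤ 1 / N)
        rw [Finset.sum_add_distrib, mul_add, hmean] at h2
        exact h2
      have hmin1 : min ε 1 * α ≤ α := mul_le_of_le_one_left hα.le (min_le_right _ _)
      have hminε : min ε 1 * α ≤ ε :=
        (mul_le_of_le_one_right (lt_min hε one_pos).le hα1.le).trans (min_le_left _ _)
      change (1 - β) * base + β * shifted < _ at ht
      have hβ' : 0 ≤ 1 - β := sub_nonneg.2 hβ1
      refine ⟨(t, lam), ⟨⟨?_, ?_⟩, hlam0, hlamL⟩, ?_⟩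
      · have h1 : 0 ≤ (1 - β) * base + β * shifted := by positivity
        have h2 : 0 < (t + 1) * α := by linarith
        have h3 := pos_of_mul_pos_left h2 hα.le
        change -1 ≤ t
        linarith
      · change t ≤ T
        rw [le_div_iff₀ (by linarith)]
        have h1 := mul_le_mul_of_nonneg_left hlower hβ0
        have h2 := mul_le_mul_of_nonneg_left hbase_lower hβ'
        have h3 := mul_le_mul_of_nonneg_left hβcost hL
        linarith
      · have hval : ∑ j, w j * F (t, lam) (y j) = shifted + lam * (θ - cost) - t * α := by
          have hj : ∀ j, w j * F (t, lam) (y j)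
              = w j * ((1 / N) * ∑ i, max (Z ((y j).1 i) + t) 0)
                - lam * (w j * ((1 / N) * ∑ i, ‖(y j).1 i - ω i‖))
                + w j * (lam * θ - t * α) := fun j => by
            simp only [F, Finset.sum_sub_distrib, ← Finset.mul_sum]
            ring
          rw [Finset.sum_congr rfl fun j _ => hj j, Finset.sum_add_distrib,
            Finset.sum_sub_distrib, ← Finset.sum_mul, hsum, ← Finset.mul_sum]
          simp only [shifted, cost]
          ring
        rw [hval]
        have h1 := mul_le_mul_of_nonneg_left hupper hβ'
        -- The diluted value is below `t * α + min ε 1 * α`; `h1` bounds the part of `shifted`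
        -- replaced by `base`, and `hbal` absorbs its error.
        linarith)
  refine ⟨t, lam, hlam.1, fun y hy => ?_⟩
  have := hall ⟨y, hy⟩
  simp only [F] at this
  linarith

/-! ### Linearizing the distance penalty -/

/-- If an affine function exceeds `r` by at most `lam` times the distance to `c` on a convex set,
the distance can be replaced by a linear function of norm at most `lam`. -/
theorem exists_norm_le_forall_sub_inner_le {n : ℕ} {Ω : Set (Unc n)} (hΩ : Convex ℝ Ω)
    {c : Unc n} (hc : c ∈ Ω) (v : Unc n) {lam r : ℝ} (hlam : 0 ≤ lam)
    (h : ∀ a ∈ Ω, inner ℝ v a - lam * ‖a - c‖ ≤ r) :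
    ∃ z : Unc n, ‖z‖ ≤ lam ∧ ∀ a ∈ Ω, inner ℝ v a - inner ℝ z (a - c) ≤ r := by
  have : Nonempty Ω := ⟨⟨c, hc⟩⟩
  obtain ⟨z, hz, hall⟩ := exists_forall_nonpos_of_weighted
    (isCompact_closedBall (0 : Unc n) lam)
    (fun z (a : Ω) => inner ℝ v (a : Unc n) - inner ℝ z ((a : Unc n) - c) - r)
    (fun a => ⟨convex_closedBall _ _, fun x _ x' _ p q _ _ hpq => le_of_eq (by
      simp only [inner_add_left, real_inner_smul_left, smul_eq_mul]
      have h1 : inner ℝ v (a : Unc n) - r = p * (inner ℝ v (a : Unc n) - r)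
        + q * (inner ℝ v (a : Unc n) - r) := by rw [← add_mul, hpq, one_mul]
      linarith)⟩)
    (fun a => by fun_prop)
    (fun ι _ w y hw hsum ε hε => by
      -- The integrand is affine in the point, so a mixture collapses to its barycentre in `Ω`.
      -- There the best `z` is `lam` times the unit vector from `c`, which division by zero turns
      -- into `0` at `a = c`.
      let a : Unc n := ∑ j, w j • (y j : Unc n)
      have ha : a ∈ Ω := hΩ.sum_mem (fun j _ => hw j) hsum fun j _ => (y j).2
      refine ⟨(lam / ‖a - c‖) • (a - c), ?_, ?_⟩
      · rw [mem_closedBall_zero_iff, norm_smul, Real.norm_of_nonneg (by positivity)]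
        rcases eq_or_ne ‖a - c‖ 0 with h0 | h0
        · simpa [h0] using hlam
        · exact (div_mul_cancel₀ _ h0).le
      · have hval : ∀ z : Unc n, ∑ j, w j * (inner ℝ v (y j : Unc n)
            - inner ℝ z ((y j : Unc n) - c) - r) = inner ℝ v a - inner ℝ z (a - c) - r := by
          intro z
          simp only [a, inner_sub_right, inner_sum, real_inner_smul_right, mul_sub,
            Finset.sum_sub_distrib, ← Finset.sum_mul, hsum, one_mul]
        rw [hval, real_inner_smul_left, real_inner_self_eq_norm_sq]
        have hnorm : lam / ‖a - c‖ * ‖a - c‖ ^ 2 = lam * ‖a - c‖ := by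
          rcases eq_or_ne ‖a - c‖ 0 with h0 | h0
          · simp [h0]
          · field_simp
        have := h a ha
        linarith)
  refine ⟨z, mem_closedBall_zero_iff.1 hz, fun a ha => ?_⟩
  have := hall ⟨a, ha⟩
  linarith

theorem convex_polyhedron {n m : ℕ} (G : Matrix (Fin m) (Fin n) ℝ) (h : Fin m → ℝ) :
    Convex ℝ (polyhedron G h) := by
  intro x hx y hy r s hr hs hrs
  change G *ᵥ (r • x.ofLp + s • y.ofLp) ≤ h
  rw [Matrix.mulVec_add, Matrix.mulVec_smul, Matrix.mulVec_smul]
  exact convex_Iic h hx hy hr hs hrs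

/-! ### The two inclusions and convexity -/

variable {nx n p K m N : ℕ}

/-- On the support, `η i k` paired with the slack `h - G a` is nonnegative, and Cauchy–Schwarz with
the norm bound `lam` controls the rest of each affine piece. Weak duality then applies with the same
`t` for every distribution. -/
theorem Data.mem_robustFeasible_of_tractable (d : Data nx n p K m N) (hK : 0 < K) (hN : 0 < N)
    (hα : 0 < d.α) (hθ : 0 ≤ d.θ) {x : Fin nx → ℝ} {lam t : ℝ} {s : Fin N → ℝ}
    {η : Fin N → Fin K → Fin m → ℝ} (h : d.Tractable x lam t s η) : x ∈ d.robustFeasible := by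
  refine ⟨h.det, iSup₂_le fun P hP => cvar_nonpos_of_le hα (t := t) (le_trans ?_ h.budget)⟩
  refine integral_le_of_mem_ambiguitySet hN hθ hP
    (((continuous_constraintFn d.D d.E d.f x hK).add continuous_const).max continuous_const)
    (fun _ => le_max_right _ _) h.lam_nonneg h.s_nonneg fun a ha i => ?_
  refine max_le ?_ (add_nonneg (h.s_nonneg i) (mul_nonneg h.lam_nonneg (norm_nonneg _)))
  change constraintFn d.D d.E d.f x a + t ≤ _
  rw [← le_sub_iff_add_le]
  refine constraintFn_le _ _ _ _ hK fun k => ?_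
  have h1 := h.epigraph i k
  have h2 := dotProduct_ofLp_le (d.E k - d.Gᵀ *ᵥ η i k) (a - d.samples i)
  have h3 := mul_le_mul_of_nonneg_right (h.dual_norm i k) (norm_nonneg (a - d.samples i))
  have h4 : η i k ⬝ᵥ (d.G *ᵥ a.ofLp) ≤ η i k ⬝ᵥ d.h :=
    dotProduct_le_dotProduct_of_nonneg_left ha (h.eta_nonneg i k)
  rw [Matrix.dotProduct_mulVec, ← Matrix.mulVec_transpose] at h4
  rw [WithLp.ofLp_sub, dotProduct_sub, sub_dotProduct _ _ a.ofLp] at h2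
  linarith

theorem Data.exists_tractable_of_mem_robustFeasible (d : Data nx n p K m N) (hK : 0 < K)
    (hN : 0 < N) (hα : 0 < d.α) (hα1 : d.α < 1) (hθ : 0 ≤ d.θ)
    (hsamples : ∀ i, d.samples i ∈ polyhedron d.G d.h) {x : Fin nx → ℝ}
    (hx : x ∈ d.robustFeasible) : ∃ lam t s η, d.Tractable x lam t s η := by
  have hNr : (0 : ℝ) < N := Nat.cast_pos.2 hN
  obtain ⟨t, lam, hlam, hy⟩ := exists_level_multiplier (measurableSet_polyhedron d.G d.h) hN
    hsamples hθ hα hα1 (slope_nonneg d.E) (constraintFn_le_add d.D d.E d.f x hK)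
    (iSup₂_le_iff.1 hx.2)
  obtain ⟨s, hs, hsum⟩ := exists_bounds_sum_le ⟨_, hsamples ⟨0, hN⟩⟩
    (fun i a => max (constraintFn d.D d.E d.f x a + t) 0 - lam * ‖a - d.samples i‖)
    (N * (t * d.α - lam * d.θ)) fun y hyΩ => by
      have := hy y hyΩ
      rw [← inv_mul_le_iff₀ hNr, ← one_div]
      linarith
  have hex : ∀ i k, ∃ η : Fin m → ℝ, 0 ≤ η ∧ ‖WithLp.toLp 2 (d.E k - d.Gᵀ *ᵥ η)‖ ≤ lam ∧
      d.D k ⬝ᵥ x - d.f k + t + (d.E k - d.Gᵀ *ᵥ η) ⬝ᵥ (d.samples i).ofLp + η ⬝ᵥ d.h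
        ≤ s i := fun i k => by
    have hinner : ∀ u b : Unc n, inner ℝ u b = u.ofLp ⬝ᵥ b.ofLp := fun u b => by
      rw [EuclideanSpace.inner_eq_star_dotProduct, star_trivial, dotProduct_comm]
    obtain ⟨z, hz, hzΩ⟩ := exists_norm_le_forall_sub_inner_le (convex_polyhedron d.G d.h)
      (hsamples i) (WithLp.toLp 2 (d.E k)) (r := s i - (d.D k ⬝ᵥ x - d.f k + t)) hlam
      fun a ha => by
        have h1 := hs i a ha
        have h2 := le_constraintFn d.D d.E d.f x a k
        have h3 := le_max_left (constraintFn d.D d.E d.f x a + t) 0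
        rw [hinner]
        dsimp only at h1 ⊢
        linarith
    -- The target `d.E k - z` is chosen so that the vector in the norm constraint, `d.E k - Gᵀ η`,
    -- is exactly `z`.
    obtain ⟨η, hη, hGη, hηh⟩ := exists_nonneg_multiplier_of_forall_polyhedron d.G d.h
      (d.E k - z.ofLp) (s i - (d.D k ⬝ᵥ x - d.f k + t) - z.ofLp ⬝ᵥ (d.samples i).ofLp)
      ⟨_, hsamples i⟩ fun a ha => by
        have h1 := hzΩ (WithLp.toLp 2 a) ha
        rw [hinner, hinner, WithLp.ofLp_sub, dotProduct_sub] at h1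
        rw [sub_dotProduct]
        dsimp only at h1
        linarith
    refine ⟨η, hη, ?_, ?_⟩
    · rw [hGη, sub_sub_cancel]
      exact hz
    · rw [hGη, sub_sub_cancel]
      linarith
  choose η hη hnorm hepi using hex
  refine ⟨lam, t, s, η, hx.1, ?_, hepi, hnorm, hη, hlam, fun i => ?_⟩
  · rw [one_div, ← le_sub_iff_add_le', inv_mul_le_iff₀ hNr]
    exact hsum
  -- At the sample itself the distance penalty vanishes, leaving a positive part below `s i`.
  · have := hs i _ (hsamples i)
    simp only [sub_self, norm_zero, mul_zero, sub_zero] at this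
    exact (le_max_right _ _).trans this

/-- All constraints are affine in the variables jointly, except for the norm of an affine map
bounded by `lam`, which is a convex cone condition. -/
theorem Data.convex_tractableFeasible (d : Data nx n p K m N) :
    Convex ℝ d.tractableFeasible := by
  rintro ⟨x, lam, t, s, η⟩ h ⟨x', lam', t', s', η'⟩ h' q r hq hr hqr
  have hsplit : ∀ i k, d.E k - d.Gᵀ *ᵥ (q • η i k + r • η' i k)
      = q • (d.E k - d.Gᵀ *ᵥ η i k) + r • (d.E k - d.Gᵀ *ᵥ η' i k) := fun i k => by
    have : d.E k = q • d.E k + r • d.E k := by rw [← add_smul, hqr, one_smul]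
    nth_rewrite 1 [this]
    rw [Matrix.mulVec_add, Matrix.mulVec_smul, Matrix.mulVec_smul, smul_sub, smul_sub]
    abel
  change d.Tractable x lam t s η at h
  change d.Tractable x' lam' t' s' η' at h'
  change d.Tractable (q • x + r • x') (q • lam + r • lam') (q • t + r • t') (q • s + r • s')
    (q • η + r • η')
  refine ⟨?_, ?_, fun i k => ?_, fun i k => ?_, fun i k => ?_, ?_, fun i => ?_⟩
  · rw [Matrix.mulVec_add, Matrix.mulVec_smul, Matrix.mulVec_smul]
    exact convex_Iic d.b h.det h'.det hq hr hqr
  · have h1 := mul_le_mul_of_nonneg_left h.budget hq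
    have h2 := mul_le_mul_of_nonneg_left h'.budget hr
    simp only [Pi.add_apply, Pi.smul_apply, smul_eq_mul, Finset.sum_add_distrib,
      ← Finset.mul_sum]
    linarith
  · have h1 := mul_le_mul_of_nonneg_left (h.epigraph i k) hq
    have h2 := mul_le_mul_of_nonneg_left (h'.epigraph i k) hr
    have hf : d.f k = q * d.f k + r * d.f k := by rw [← add_mul, hqr, one_mul]
    simp only [Pi.add_apply, Pi.smul_apply, hsplit]
    simp only [smul_eq_mul, add_dotProduct, smul_dotProduct, dotProduct_add, dotProduct_smul]
    linarith
  · simp only [Pi.add_apply, Pi.smul_apply, hsplit]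
    rw [WithLp.toLp_add, WithLp.toLp_smul, WithLp.toLp_smul]
    refine (norm_add_le _ _).trans ?_
    rw [norm_smul, norm_smul, Real.norm_of_nonneg hq, Real.norm_of_nonneg hr]
    exact add_le_add (mul_le_mul_of_nonneg_left (h.dual_norm i k) hq)
      (mul_le_mul_of_nonneg_left (h'.dual_norm i k) hr)
  · exact add_nonneg (smul_nonneg hq (h.eta_nonneg i k)) (smul_nonneg hr (h'.eta_nonneg i k))
  · exact add_nonneg (smul_nonneg hq h.lam_nonneg) (smul_nonneg hr h'.lam_nonneg)
  · exact add_nonneg (smul_nonneg hq (h.s_nonneg i)) (smul_nonneg hr (h'.s_nonneg i))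

end DRCVP

/-! ### Equivalence of the programs -/

/-- For samples in the polyhedral support, the distributionally robust CVaR-constrained program
and its finite-dimensional reformulation are equivalent: the feasible set of the former is the
projection to the `x`-component of that of the latter, the optimal values agree, and the optimal
solutions correspond. Moreover, the reformulation is a convex program. -/
theorem proposition1 {nx n p K m N : ℕ} (hK : 0 < K) (hN : 0 < N)
    (d : DRCVP.Data nx n p K m N)
    (hα : 0 < d.α ∧ d.α < 1) (hθ : 0 ≤ d.θ)
    (hsamples : ∀ i, d.samples i ∈ DRCVP.polyhedron d.G d.h) :
    (∀ x : Fin nx → ℝ, x ∈ d.robustFeasible ↔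
      ∃ (lam t : ℝ) (s : Fin N → ℝ) (η : Fin N → Fin K → Fin m → ℝ),
        (x, lam, t, s, η) ∈ d.tractableFeasible) ∧
    DRCVP.optValue d.robustFeasible d.robustCost
      = DRCVP.optValue d.tractableFeasible d.tractableCost ∧
    (∀ x : Fin nx → ℝ, DRCVP.IsOptimal d.robustFeasible d.robustCost x ↔
      ∃ (lam t : ℝ) (s : Fin N → ℝ) (η : Fin N → Fin K → Fin m → ℝ),
        DRCVP.IsOptimal d.tractableFeasible d.tractableCost (x, lam, t, s, η)) ∧
    Convex ℝ d.tractableFeasible ∧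
    ConvexOn ℝ d.tractableFeasible d.tractableCost := by
  have hfeas : ∀ x : Fin nx → ℝ, x ∈ d.robustFeasible ↔
      ∃ (lam t : ℝ) (s : Fin N → ℝ) (η : Fin N → Fin K → Fin m → ℝ),
        (x, lam, t, s, η) ∈ d.tractableFeasible := fun x =>
    ⟨d.exists_tractable_of_mem_robustFeasible hK hN hα.1 hα.2 hθ hsamples,
      fun ⟨_, _, _, _, h⟩ => d.mem_robustFeasible_of_tractable hK hN hα.1 hθ h⟩
  have hproj : ∀ v ∈ d.tractableFeasible, v.1 ∈ d.robustFeasible := fun v hv =>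
    (hfeas v.1).2 ⟨_, _, _, _, hv⟩
  refine ⟨hfeas, le_antisymm ?_ ?_, fun x => ⟨?_, ?_⟩, d.convex_tractableFeasible,
    d.convex_tractableFeasible, fun v _ v' _ q r _ _ _ => ?_⟩
  · exact le_iInf₂ fun v hv => iInf₂_le v.1 (hproj v hv)
  · refine le_iInf₂ fun x hx => ?_
    obtain ⟨lam, t, s, η, h⟩ := (hfeas x).1 hx
    exact iInf₂_le (x, lam, t, s, η) h
  · rintro ⟨hx, hmin⟩
    obtain ⟨lam, t, s, η, h⟩ := (hfeas x).1 hx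
    exact ⟨lam, t, s, η, h, fun v hv => hmin (hproj v hv)⟩
  · rintro ⟨lam, t, s, η, h, hmin⟩
    refine ⟨(hfeas x).2 ⟨lam, t, s, η, h⟩, fun y hy => ?_⟩
    obtain ⟨lam', t', s', η', h'⟩ := (hfeas y).1 hy
    exact hmin h'
  · simp only [DRCVP.Data.tractableCost, Prod.fst_add, Prod.smul_fst, dotProduct_add,
      dotProduct_smul]
    exact le_rfl
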